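/- Let $(X,d_X)$ be a compact metric space with its Borel $\sigma$-algebra, let $A\subset\mathbb R^m$ be compact and convex (with the Euclidean norm), and let $\mathcal P(\cdot)$ denote the space of Borel probability measures with the topology of weak convergence. Let $c:X\times A\times\mathcal P(X)\to\mathbb R$ be a cost function, $p:X\times A\times\mathcal P(X)\to\mathcal P(X)$ a transition probability, $\mu_0\in\mathcal P(X)$ an initial state-measure and $\beta\in[0,1)$ a discount factor. Assume: 1. if $(x_n,a_n,\mu_n)\to(x,a,\mu)$ in $X\times A\times\mathcal P(X)$, then $c(x_n,a_n,\mu_n)\to c(x,a,\mu)$ and $p(\cdot\,|\,x_n,a_n,\mu_n)\to p(\cdot\,|\,x,a,\mu)$ weakly; 2. there are constants $L,K,M$ such that for all $x,\hat x\in X$, $a,\hat a\in A$, $\mu\in\mathcal P(X)$: $|c(x,a,\mu)-c(\hat x,\hat a,\mu)|\le L\,(d_X(x,\hat x)+\|a-\hat a\|)$, $W_1(p(\cdot|x,a,\mu),p(\cdot|\hat x,\hat a,\mu))\le K\,(d_X(x,\hat x)+\|a-\hat a\|)$ and $|c(x,a,\mu)|\le M$, where $W_1(\mu,\nu)=\sup_g\left|\int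 g\,d\mu-\int g\,d\nu\right|$ over all $g:X\to\mathbb R$ with Lipschitz coefficient at most $1$. A Markov policy is a sequence $\boldsymbol\pi=(\pi_t)_t$ of stochastic kernels from $X$ to $A$. For a flow $\boldsymbol\mu=(\mu_t)_t$ in $\mathcal P(X)$, let $E^{\boldsymbol\pi}$ be the expectation for the process with $x_0\sim\mu_0$, $a_t\sim\pi_t(\cdot|x_t)$, $x_{t+1}\sim p(\cdot|x_t,a_t,\mu_t)$. For $T\in\mathbb N\cup\{\infty\}$, a mean-field equilibrium (MFE) with horizon $T$ is a pair $(\boldsymbol\pi,\boldsymbol\mu)$ of flows indexed by the integers $0\le t\le T$ (all $t\ge 0$ if $T=\infty$) whose measure flow starts at the given $\mu_0$, such that $\boldsymbol\pi$ minimizes $\tilde{\boldsymbol\pi}\mapsto E^{\tilde{\boldsymbol\pi}}\left[\sum_{t=0}^{T}\beta^t c(x_t,a_t,\mu_t)\right]$ over all Markov policies, and $$\mu_{t+1}(\cdot)=\int_X\int_A p(\cdot|x,a,\mu_t)\,\pi_t(da|x)\,\mu_t(dx)\qquad(0\le t<T).$$ The case $T=\infty$ is the non-stationary infinite-horizon game.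 Write $(\pi_t\otimes\mu_t)(dx,da)=\pi_t(da|x)\mu_t(dx)$. For finite $T$, let $\mathrm{EMFE}_T\subset\mathcal P(X\times A)^{\mathbb N}$ be the set of the flows $(\tilde\pi_t\otimes\tilde\mu_t)_{t\ge0}$, where $(\boldsymbol\pi,\boldsymbol\mu)$ is an MFE with horizon $T$, $(\tilde\pi_t,\tilde\mu_t)=(\pi_t,\mu_t)$ for $t\le T$ and $(\tilde\pi_t,\tilde\mu_t)=(\pi_T,\mu_T)$ for $t>T$. **Theorem.** Let $\boldsymbol\rho=(\rho_t)_{t\ge0}\in\mathcal P(X\times A)^{\mathbb N}$ be an accumulation point of the sets $\mathrm{EMFE}_T$ as $T\to\infty$ in the product of the weak topologies, i.e. every neighbourhood of $\boldsymbol\rho$ meets $\mathrm{EMFE}_T$ for arbitrarily large $T$. Then $\boldsymbol\rho$ disintegrates as $\rho_t=\hat\pi_t\otimes\hat\mu_t$ $(t\ge0)$ with stochastic kernels $\hat\pi_t$ from $X$ to $A$ and $\hat\mu_t\in\mathcal P(X)$, and for every such disintegration $((\hat\pi_t)_t,(\hat\mu_t)_t)$ is an MFE of the non-stationary infinite-horizon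 game. -/

import Mathlib

open MeasureTheory ProbabilityTheory Filter Topology
open scoped ENNReal

noncomputable section

/-- The data of a discrete-time mean-field game with discounted cost on the state space `X` and the
action space `A`: one-stage cost `c`, transition probability `p` (a stochastic kernel for each
fixed state-measure), initial state-measure `μ₀` and discount factor `β ∈ [0, 1)`. The same data
give the finite-horizon games (one for each horizon `T`) and the infinite-horizon non-stationary
game. -/
structure MeanFieldGame (X A : Type*) [MeasurableSpace X] [MeasurableSpace A] where
  /-- one-stage cost -/
  c : X → A → ProbabilityMeasure X → ℝ
  /-- law of the next state, given state, action and state-measure -/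
  p : X → A → ProbabilityMeasure X → ProbabilityMeasure X
  measurable_p : ∀ μ, Measurable fun z : X × A => (p z.1 z.2 μ : Measure X)
  /-- initial state-measure -/
  μ₀ : ProbabilityMeasure X
  /-- discount factor -/
  β : ℝ
  β_nonneg : 0 ≤ β
  β_lt_one : β < 1

/-- A flow of Markov policies: at each time `t`, a stochastic kernel from states to actions. -/
structure MarkovPolicy (X A : Type*) [MeasurableSpace X] [MeasurableSpace A] where
  kernel : ℕ → Kernel X A
  markov : ∀ t, IsMarkovKernel (kernel t)

instance {X A : Type*} [MeasurableSpace X] [MeasurableSpace A] (π : MarkovPolicy X A) (t : ℕ) :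
    IsMarkovKernel (π.kernel t) := π.markov t

/-- The joint state-action flow `(π_t ⊗ μ_t)_t`, where
`(π_t ⊗ μ_t)(dx, da) = π_t(da | x) μ_t(dx)`. -/
def stateActionFlow {X A : Type*} [MeasurableSpace X] [MeasurableSpace A]
    (π : MarkovPolicy X A) (μ : ℕ → ProbabilityMeasure X) : ℕ → ProbabilityMeasure (X × A) :=
  fun t => ⟨(μ t : Measure X) ⊗ₘ π.kernel t, inferInstance⟩

/-- Freezing a flow of policies after time `T`: `π_t` for `t ≤ T` and `π_T` for `t > T`. -/
def MarkovPolicy.freeze {X A : Type*} [MeasurableSpace X] [MeasurableSpace A]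
    (π : MarkovPolicy X A) (T : ℕ) : MarkovPolicy X A where
  kernel t := if t ≤ T then π.kernel t else π.kernel T
  markov t := by split_ifs <;> infer_instance

/-- Freezing a flow of state-measures after time `T`: `μ_t` for `t ≤ T` and `μ_T` for `t > T`. -/
def freezeMeasures {X : Type*} [MeasurableSpace X] (μ : ℕ → ProbabilityMeasure X) (T : ℕ) :
    ℕ → ProbabilityMeasure X :=
  fun t => if t ≤ T then μ t else μ T

/-- The `1`-Wasserstein distance (Kantorovich form): the supremum of `|∫ g dμ - ∫ g dν|` over all
`g : X → ℝ` with Lipschitz coefficient at most `1`, as an extended nonnegative real. It is used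
on compact spaces only, where every such `g` is integrable. -/
def wassersteinOne {X : Type*} [PseudoMetricSpace X] [MeasurableSpace X]
    (μ ν : ProbabilityMeasure X) : ℝ≥0∞ :=
  ⨆ (g : X → ℝ) (_ : LipschitzWith 1 g), ENNReal.ofReal |∫ x, g x ∂μ - ∫ x, g x ∂ν|

namespace MeanFieldGame

section Dynamics

variable {X A : Type*} [MeasurableSpace X] [MeasurableSpace A]

/-- The transition kernel `p(· | x, a, μ)` for a fixed state-measure `μ`. -/
def transition (G : MeanFieldGame X A) (μ : ProbabilityMeasure X) : Kernel (X × A) X where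
  toFun z := (G.p z.1 z.2 μ : Measure X)
  measurable' := G.measurable_p μ

instance (G : MeanFieldGame X A) (μ : ProbabilityMeasure X) : IsMarkovKernel (G.transition μ) :=
  ⟨fun z => inferInstanceAs (IsProbabilityMeasure (G.p z.1 z.2 μ : Measure X))⟩

/-- One step of the state-action process of a single player who uses the policy `π` against the
flow `μ`: given `(x_t, a_t)`, first `x_{t+1} ∼ p(· | x_t, a_t, μ_t)`, then
`a_{t+1} ∼ π_{t+1}(· | x_{t+1})`. -/
def stepKernel (G : MeanFieldGame X A) (μ : ℕ → ProbabilityMeasure X) (π : MarkovPolicy X A)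
    (t : ℕ) : Kernel (X × A) (X × A) :=
  G.transition (μ t) ⊗ₖ Kernel.prodMkLeft (X × A) (π.kernel (t + 1))

instance (G : MeanFieldGame X A) (μ : ℕ → ProbabilityMeasure X) (π : MarkovPolicy X A) (t : ℕ) :
    IsMarkovKernel (G.stepKernel μ π t) := by
  unfold stepKernel; infer_instance

/-- The step kernel as a function of the whole history up to time `t`. -/
def historyKernel (G : MeanFieldGame X A) (μ : ℕ → ProbabilityMeasure X) (π : MarkovPolicy X A)
    (t : ℕ) : Kernel (Finset.Iic t → X × A) (X × A) :=
  (G.stepKernel μ π t).comap (fun h => h ⟨t, Finset.mem_Iic.2 le_rfl⟩) (measurable_pi_apply _)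

instance (G : MeanFieldGame X A) (μ : ℕ → ProbabilityMeasure X) (π : MarkovPolicy X A) (t : ℕ) :
    IsMarkovKernel (G.historyKernel μ π t) := by
  unfold historyKernel; infer_instance

/-- The law on `(X × A)^ℕ` of the state-action process `(x_t, a_t)_t` of a single player who uses
the policy `π` against the flow `μ`, started from `x_0 ∼ μ₀`, `a_0 ∼ π_0(· | x_0)`. -/
def pathLaw (G : MeanFieldGame X A) (μ : ℕ → ProbabilityMeasure X) (π : MarkovPolicy X A) :
    Measure (ℕ → X × A) :=
  Kernel.trajMeasure (X := fun _ : ℕ => X × A) ((G.μ₀ : Measure X) ⊗ₘ π.kernel 0)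
    (G.historyKernel μ π)

/-- The discounted cost `E^π [∑_{t=0}^T β^t c(x_t, a_t, μ_t)]` with horizon `T`. -/
def finiteCost (G : MeanFieldGame X A) (T : ℕ) (μ : ℕ → ProbabilityMeasure X)
    (π : MarkovPolicy X A) : ℝ :=
  ∫ ω, ∑ t ∈ Finset.range (T + 1), G.β ^ t * G.c (ω t).1 (ω t).2 (μ t) ∂(G.pathLaw μ π)

/-- The discounted cost `E^π [∑_{t=0}^∞ β^t c(x_t, a_t, μ_t)]` with infinite horizon. -/
def infiniteCost (G : MeanFieldGame X A) (μ : ℕ → ProbabilityMeasure X)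
    (π : MarkovPolicy X A) : ℝ :=
  ∫ ω, ∑' t : ℕ, G.β ^ t * G.c (ω t).1 (ω t).2 (μ t) ∂(G.pathLaw μ π)

/-- The law `∫ p(· | x, a, μ_t) π_t(da | x) μ_t(dx)` of the next state of the population. -/
def nextMeasure (G : MeanFieldGame X A) (μ : ℕ → ProbabilityMeasure X) (π : MarkovPolicy X A)
    (t : ℕ) : Measure X :=
  ((μ t : Measure X) ⊗ₘ π.kernel t).bind (G.transition (μ t))

/-- `(π, μ)` is a mean-field equilibrium of the game with horizon `T`. The flows are indexed by all
of `ℕ`, but only their terms with index `t ≤ T` matter here. -/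
def IsFiniteMFE (G : MeanFieldGame X A) (T : ℕ) (π : MarkovPolicy X A)
    (μ : ℕ → ProbabilityMeasure X) : Prop :=
  (∀ π' : MarkovPolicy X A, G.finiteCost T μ π ≤ G.finiteCost T μ π') ∧
    μ 0 = G.μ₀ ∧ ∀ t < T, (μ (t + 1) : Measure X) = G.nextMeasure μ π t

/-- `(π, μ)` is a mean-field equilibrium of the infinite-horizon non-stationary game. -/
def IsInfiniteMFE (G : MeanFieldGame X A) (π : MarkovPolicy X A)
    (μ : ℕ → ProbabilityMeasure X) : Prop :=
  (∀ π' : MarkovPolicy X A, G.infiniteCost μ π ≤ G.infiniteCost μ π') ∧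
    μ 0 = G.μ₀ ∧ ∀ t, (μ (t + 1) : Measure X) = G.nextMeasure μ π t

/-- The set of the joint state-action flows of all mean-field equilibria of the game with horizon
`T`, extended to infinite flows by freezing them after time `T`. -/
def extendedMFE (G : MeanFieldGame X A) (T : ℕ) : Set (ℕ → ProbabilityMeasure (X × A)) :=
  {ρ | ∃ (π : MarkovPolicy X A) (μ : ℕ → ProbabilityMeasure X),
    G.IsFiniteMFE T π μ ∧ ρ = stateActionFlow (π.freeze T) (freezeMeasures μ T)}

end Dynamics

section Topology

variable {X A : Type*} [MeasurableSpace X] [MeasurableSpace A]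

/-- `ρ` is an accumulation point, as the horizon `T` tends to infinity, of extended finite-horizon
equilibria: every neighbourhood of `ρ`, in the product over `t` of the topologies of weak
convergence, meets `extendedMFE G T` for arbitrarily large `T`. -/
def IsHorizonAccumulationPoint [TopologicalSpace X] [TopologicalSpace A]
    [OpensMeasurableSpace (X × A)] (G : MeanFieldGame X A)
    (ρ : ℕ → ProbabilityMeasure (X × A)) : Prop :=
  ∀ U ∈ 𝓝 ρ, ∃ᶠ T in atTop, (U ∩ G.extendedMFE T).Nonempty

/-- Continuous convergence of the cost and weakly continuous convergence of the transition
probability. -/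
def ContinuousConvergence [TopologicalSpace X] [TopologicalSpace A] [OpensMeasurableSpace X]
    (G : MeanFieldGame X A) : Prop :=
  ∀ (x : ℕ → X) (a : ℕ → A) (μ : ℕ → ProbabilityMeasure X) (x' : X) (a' : A)
    (μ' : ProbabilityMeasure X),
    Tendsto x atTop (𝓝 x') → Tendsto a atTop (𝓝 a') → Tendsto μ atTop (𝓝 μ') →
      Tendsto (fun n => G.c (x n) (a n) (μ n)) atTop (𝓝 (G.c x' a' μ')) ∧
      Tendsto (fun n => G.p (x n) (a n) (μ n)) atTop (𝓝 (G.p x' a' μ'))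

/-- The cost and the transition probability are Lipschitz in state and action, uniformly in the
state-measure, and the cost is bounded. -/
def LipschitzBounded [PseudoMetricSpace X] [PseudoMetricSpace A] (G : MeanFieldGame X A) : Prop :=
  (∃ L : ℝ, ∀ x x' a a' μ, |G.c x a μ - G.c x' a' μ| ≤ L * (dist x x' + dist a a')) ∧
  (∃ K : ℝ, ∀ x x' a a' μ,
    wassersteinOne (G.p x a μ) (G.p x' a' μ) ≤ ENNReal.ofReal (K * (dist x x' + dist a a'))) ∧
  (∃ M : ℝ, ∀ x a μ, |G.c x a μ| ≤ M)

end Topology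

end MeanFieldGame

end

/-! Policies need not converge, but state-action laws do, so every property of an equilibrium is
phrased as a closed condition on the flow `ρ` alone and passed to the limit by
`IsHorizonAccumulationPoint.mem_of_isClosed`. Three conditions suffice: the initial marginal,
consistency tested against bounded continuous functions (`stateMarginals_succ`), and near-optimality
in each `N`-stage problem (`sum_integral_cost_le`).

For the third, optimality among all policies is replaced by comparison with the dynamic programming
value. This value is jointly continuous in flow and state, bounds every policy's cost from below
(`integral_value_le_costFrom`), and is approached by measurable selection (`exists_partialCost_le`).
Since costs are bounded by `M`, cutting any horizon at `N` costs at most `τ = M β^N / (1 - β)`. An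
equilibrium with horizon `T ≥ N` is therefore within `2τ` of the `N`-stage value, uniformly in `T`.
The limit inherits this bound; two more tails lead to infinite-horizon costs, and `N → ∞` gives
optimality. -/

/-! ### Continuity of parametrized integrals and infima; measurable selection -/

/-- Integrals of a jointly continuous function against a weakly continuous family of probability
measures on a compact space depend continuously on the parameter. -/
theorem continuous_integral_probabilityMeasure {Θ Y : Type*} [TopologicalSpace Θ]
    [TopologicalSpace Y] [CompactSpace Y] [MeasurableSpace Y] [OpensMeasurableSpace Y]
    {v : Θ → Y → ℝ} (hv : Continuous (Function.uncurry v)) {ν : Θ → ProbabilityMeasure Y}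
    (hν : Continuous ν) : Continuous fun θ => ∫ y, v θ y ∂(ν θ : Measure Y) := by
  -- Currying turns joint continuity into continuity for the sup norm on `C(Y, ℝ)`, so the change of
  -- integrand is small uniformly in the measure.
  let F : C(Θ, C(Y, ℝ)) := ContinuousMap.curry ⟨Function.uncurry v, hv⟩
  refine continuous_iff_continuousAt.2 fun θ₀ => ?_
  have h₁ : Tendsto (fun θ => ∫ y, F θ₀ y ∂(ν θ : Measure Y)) (𝓝 θ₀)
      (𝓝 (∫ y, F θ₀ y ∂(ν θ₀ : Measure Y))) :=
    ((ProbabilityMeasure.continuous_integral_continuousMap (F θ₀)).comp hν).tendsto θ₀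
  have hint : ∀ (f : C(Y, ℝ)) (θ : Θ), Integrable f (ν θ : Measure Y) := fun f θ =>
    (BoundedContinuousFunction.mkOfCompact f).integrable _
  have h₂ : Tendsto (fun θ => ∫ y, F θ y ∂(ν θ : Measure Y) - ∫ y, F θ₀ y ∂(ν θ : Measure Y))
      (𝓝 θ₀) (𝓝 0) := by
    have hF : Tendsto (fun θ => ‖F θ - F θ₀‖) (𝓝 θ₀) (𝓝 0) := by
      simpa using ((F.continuous.sub continuous_const).norm).tendsto (x := θ₀)
        (f := fun θ => ‖F θ - F θ₀‖)
    refine squeeze_zero_norm (fun θ => ?_) hF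
    rw [← integral_sub (hint _ _) (hint _ _)]
    simpa using norm_integral_le_of_norm_le_const (μ := (ν θ : Measure Y))
      (ae_of_all _ fun y => (F θ - F θ₀).norm_coe_le_norm y)
  have h₃ := h₂.add h₁
  simp only [sub_add_cancel, zero_add] at h₃
  exact h₃

/-- Infima over a compact parameter space of a jointly continuous function are continuous. -/
theorem continuous_iInf_of_compact {Θ A : Type*} [TopologicalSpace Θ] [TopologicalSpace A]
    [CompactSpace A] {q : Θ → A → ℝ} (hq : Continuous (Function.uncurry q)) :
    Continuous fun θ => ⨅ a, q θ a := by
  simpa [Set.image_univ, sInf_range] using isCompact_univ.continuous_sInf (f := q) hq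

/-- A real `⨅` is a lower bound only for families bounded below; this supplies the side condition of
`ciInf_le`. -/
theorem bddBelow_range_of_compact {Θ A : Type*} [TopologicalSpace Θ] [TopologicalSpace A]
    [CompactSpace A] {q : Θ → A → ℝ} (hq : Continuous (Function.uncurry q)) (θ : Θ) :
    BddBelow (Set.range (q θ)) :=
  (isCompact_range (hq.comp (Continuous.prodMk_right θ))).bddBelow

/-- Measurable selection of approximate minimizers. -/
theorem exists_measurable_approx_minimizer {X A : Type*} [TopologicalSpace X] [MeasurableSpace X]
    [OpensMeasurableSpace X] [TopologicalSpace A] [CompactSpace A]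
    [TopologicalSpace.SeparableSpace A] [Nonempty A] [MeasurableSpace A] {q : X → A → ℝ}
    (hq : Continuous (Function.uncurry q)) {ε : ℝ} (hε : 0 < ε) :
    ∃ s : X → A, Measurable s ∧ ∀ x, q x (s x) ≤ (⨅ a, q x a) + ε := by
  classical
  let u := TopologicalSpace.denseSeq A
  -- The slack `ε` makes the condition strict, hence open: a dense sequence meets it, and the first
  -- index that works depends measurably on `x`.
  have hex : ∀ x, ∃ n, q x (u n) < (⨅ a, q x a) + ε := fun x => by
    obtain ⟨a, ha⟩ := exists_lt_of_ciInf_lt (lt_add_of_pos_right (⨅ a, q x a) hε)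
    obtain ⟨n, hn⟩ := (TopologicalSpace.denseRange_denseSeq A).exists_mem_open
      (isOpen_lt (hq.comp (Continuous.prodMk_right x)) continuous_const) ⟨a, ha⟩
    exact ⟨n, hn⟩
  refine ⟨fun x => u (Nat.find (hex x)), ?_, fun x => (Nat.find_spec (hex x)).le⟩
  refine (measurable_from_nat (f := u)).comp (measurable_find hex fun n => ?_)
  exact (isOpen_lt (hq.comp (Continuous.prodMk_left (u n)))
    ((continuous_iInf_of_compact hq).add continuous_const)).measurableSet

/-! ### Integration against kernels and geometric tails -/

theorem Continuous.integrable_of_compactSpace {Y : Type*} [TopologicalSpace Y] [CompactSpace Y]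
    [MeasurableSpace Y] [OpensMeasurableSpace Y] {f : Y → ℝ} (hf : Continuous f) (μ : Measure Y)
    [IsFiniteMeasure μ] : Integrable f μ :=
  (BoundedContinuousFunction.mkOfCompact ⟨f, hf⟩).integrable μ

/-- `μ.bind κ` is the second marginal of `μ ⊗ₘ κ`, so this is Fubini for the latter. -/
theorem MeasureTheory.Measure.integral_bind_kernel {Y Z : Type*} [MeasurableSpace Y]
    [MeasurableSpace Z] (μ : Measure Y) [SFinite μ] (κ : Kernel Y Z) [IsSFiniteKernel κ] {f : Z → ℝ}
    (hf : Integrable f (μ.bind κ)) : ∫ z, f z ∂(μ.bind κ) = ∫ y, ∫ z, f z ∂(κ y) ∂μ := by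
  have h := (Measure.integrable_compProd_snd_iff hf.1).2 hf
  rw [← Measure.integral_compProd h, ← Measure.snd_compProd, Measure.snd,
    integral_map measurable_snd.aemeasurable]
  rw [← Measure.snd, Measure.snd_compProd]
  exact hf.1

theorem MeasureTheory.Measure.bind_compProd_prodMkLeft {Y Z W : Type*} [MeasurableSpace Y]
    [MeasurableSpace Z] [MeasurableSpace W] (μ : Measure Y) [SFinite μ] (κ : Kernel Y Z)
    [IsSFiniteKernel κ] (η : Kernel Z W) [IsSFiniteKernel η] :
    μ.bind (κ ⊗ₖ Kernel.prodMkLeft Y η) = (μ.bind κ) ⊗ₘ η := by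
  refine Measure.ext_of_lintegral _ fun f hf => ?_
  rw [Measure.lintegral_bind (Kernel.aemeasurable _) hf.aemeasurable, Measure.lintegral_compProd hf,
    Measure.lintegral_bind (Kernel.aemeasurable _) hf.lintegral_kernel_prod_right'.aemeasurable]
  refine lintegral_congr fun y => ?_
  rw [Kernel.lintegral_compProd _ _ _ hf]
  simp

theorem abs_sum_range_sub_sum_range_le_geometric {u : ℕ → ℝ} {C r : ℝ} (hr : r < 1)
    (hr₀ : 0 ≤ r) (hu : ∀ n, |u n| ≤ C * r ^ n) {N K : ℕ} (hNK : N ≤ K) :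
    |∑ t ∈ Finset.range N, u t - ∑ t ∈ Finset.range K, u t| ≤ C * r ^ N / (1 - r) := by
  have hC : 0 ≤ C := by simpa using (abs_nonneg _).trans (hu 0)
  -- Extending by zero from `K` on makes the finite sum the total of a series, to which the
  -- geometric tail bound applies.
  let w : ℕ → ℝ := fun t => if t < K then u t else 0
  have hw : ∀ n, ‖w n‖ ≤ C * r ^ n := fun n => by
    by_cases h : n < K
    · simpa [w, h] using hu n
    · simpa [w, h] using by positivity
  have hsum : HasSum w (∑ t ∈ Finset.range K, w t) :=
    hasSum_sum_of_ne_finset_zero fun t ht => by simp_all [w]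
  have h := norm_sub_le_of_geometric_bound_of_hasSum hr hw hsum N
  have e : ∀ n ≤ K, ∑ t ∈ Finset.range n, w t = ∑ t ∈ Finset.range n, u t := fun n hn =>
    Finset.sum_congr rfl fun t ht => if_pos ((Finset.mem_range.1 ht).trans_le hn)
  rwa [e N hNK, e K le_rfl, Real.norm_eq_abs] at h

namespace MeanFieldGame

/-! ### One-time laws of the state-action process -/

section Law

variable {X A : Type*} [MeasurableSpace X] [MeasurableSpace A] (G : MeanFieldGame X A)
  (μ : ℕ → ProbabilityMeasure X) (π : MarkovPolicy X A)

instance : IsProbabilityMeasure (G.pathLaw μ π) := by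
  unfold pathLaw; infer_instance

/-- The law of the state-action pair `(x_t, a_t)`. -/
noncomputable def stateActionLaw (t : ℕ) : Measure (X × A) := (G.pathLaw μ π).map fun ω => ω t

instance (t : ℕ) : IsProbabilityMeasure (G.stateActionLaw μ π t) :=
  Measure.isProbabilityMeasure_map (measurable_pi_apply t).aemeasurable

theorem stateActionLaw_zero : G.stateActionLaw μ π 0 = (G.μ₀ : Measure X) ⊗ₘ π.kernel 0 := by
  -- The coordinate at time 0 factors through the history up to time 0, on which the trajectory
  -- kernel is the identity.
  have h : (fun ω : ℕ → X × A => ω 0) = (fun y => y ⟨0, Finset.mem_Iic.2 le_rfl⟩) ∘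
      Preorder.frestrictLe (π := fun _ => X × A) 0 := rfl
  rw [stateActionLaw, pathLaw, Kernel.trajMeasure, h,
    ← Measure.map_map (measurable_pi_apply _) (by fun_prop),
    Measure.map_comp _ _ (by fun_prop), Kernel.traj_map_frestrictLe, Kernel.partialTraj_self,
    Measure.id_comp, Measure.map_map (measurable_pi_apply _) (by fun_prop)]
  exact Measure.map_id

/-- The joint law of the history and the next pair has this law as second marginal; the history
kernel reads only the last coordinate, so the history can be integrated out. -/
theorem stateActionLaw_succ (t : ℕ) : G.stateActionLaw μ π (t + 1) =
    (G.stateActionLaw μ π t).bind (G.transition (μ t)) ⊗ₘ π.kernel (t + 1) := by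
  have h := congrArg Measure.snd (Kernel.map_frestrictLe_trajMeasure_compProd_eq_map_trajMeasure
    (X := fun _ : ℕ => X × A) (μ₀ := (G.μ₀ : Measure X) ⊗ₘ π.kernel 0)
    (κ := G.historyKernel μ π) (a := t))
  rw [Measure.snd_compProd, Measure.snd, Measure.map_map measurable_snd (by fun_prop)] at h
  refine h.symm.trans ?_
  rw [← Measure.bind_compProd_prodMkLeft]
  refine Measure.ext_of_lintegral _ fun f hf => ?_
  have hm : Measurable fun z => ∫⁻ w, f w ∂(G.stepKernel μ π t z) := hf.lintegral_kernel
  rw [Measure.lintegral_bind (Kernel.aemeasurable _) hf.aemeasurable,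
    Measure.lintegral_bind (Kernel.aemeasurable _) hf.aemeasurable, stateActionLaw,
    lintegral_map hf.lintegral_kernel (by fun_prop)]
  exact (lintegral_map hm (measurable_pi_apply t)).symm

theorem fst_stateActionLaw_zero : (G.stateActionLaw μ π 0).fst = G.μ₀ := by
  rw [stateActionLaw_zero, Measure.fst_compProd]

theorem fst_stateActionLaw_succ (t : ℕ) : (G.stateActionLaw μ π (t + 1)).fst =
    (G.stateActionLaw μ π t).bind (G.transition (μ t)) := by
  rw [stateActionLaw_succ, Measure.fst_compProd]

theorem stateActionLaw_eq_fst_compProd (t : ℕ) :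
    G.stateActionLaw μ π t = (G.stateActionLaw μ π t).fst ⊗ₘ π.kernel t := by
  cases t with
  | zero => rw [fst_stateActionLaw_zero, stateActionLaw_zero]
  | succ t => rw [fst_stateActionLaw_succ, stateActionLaw_succ]

/-- Along a consistent flow, the state-action law of a player is that of the population. -/
theorem stateActionLaw_eq_of_consistent {T : ℕ∞} (h₀ : μ 0 = G.μ₀)
    (h : ∀ t : ℕ, (t : ℕ∞) < T → (μ (t + 1) : Measure X) = G.nextMeasure μ π t) :
    ∀ t : ℕ, (t : ℕ∞) ≤ T → G.stateActionLaw μ π t = (μ t : Measure X) ⊗ₘ π.kernel t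
  | 0, _ => by rw [stateActionLaw_zero, h₀]
  | t + 1, ht => by
    have hlt : (t : ℕ∞) < T := lt_of_lt_of_le (by exact_mod_cast t.lt_succ_self) ht
    rw [stateActionLaw_succ, stateActionLaw_eq_of_consistent h₀ h t hlt.le, h t hlt, nextMeasure]

end Law

/-! ### Dynamic programming and partial costs -/

section Value

variable {X A : Type*} [MeasurableSpace X] [MeasurableSpace A]

/-- The optimal cost of the `k` stages that start at time `t`, by dynamic programming against the
flow `μ`. -/
noncomputable def value (G : MeanFieldGame X A) (μ : ℕ → ProbabilityMeasure X) : ℕ → ℕ → X → ℝ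
  | 0, _, _ => 0
  | k + 1, t, x => ⨅ a, (G.c x a (μ t) + G.β * ∫ y, G.value μ k (t + 1) y ∂(G.p x a (μ t)))

/-- The one-stage cost followed by the optimal cost of the next `k` stages. -/
noncomputable def actionValue (G : MeanFieldGame X A) (μ : ℕ → ProbabilityMeasure X) (k t : ℕ)
    (x : X) (a : A) : ℝ :=
  G.c x a (μ t) + G.β * ∫ y, G.value μ k (t + 1) y ∂(G.p x a (μ t))

theorem value_succ (G : MeanFieldGame X A) (μ : ℕ → ProbabilityMeasure X) (k t : ℕ) (x : X) :
    G.value μ (k + 1) t x = ⨅ a, G.actionValue μ k t x a := rfl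

/-- Lets the equilibrium flow replace its frozen extension, with which it need agree only up to the
horizon. -/
theorem value_congr (G : MeanFieldGame X A) {μ μ' : ℕ → ProbabilityMeasure X} (k : ℕ) :
    ∀ t, (∀ s < t + k, μ s = μ' s) → G.value μ k t = G.value μ' k t := by
  induction k with
  | zero => intros; rfl
  | succ k ih =>
    intro t h
    funext x
    simp only [value]
    rw [ih (t + 1) fun s hs => h s (by omega), h t (by omega)]

/-- The expected discounted cost of the first `N` stages. -/
noncomputable def partialCost (G : MeanFieldGame X A) (μ : ℕ → ProbabilityMeasure X)
    (π : MarkovPolicy X A) (N : ℕ) : ℝ :=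
  ∑ t ∈ Finset.range N, G.β ^ t * ∫ z, G.c z.1 z.2 (μ t) ∂(G.stateActionLaw μ π t)

/-- The expected cost of the `k` stages that start at time `t`, discounted to time `t`. -/
noncomputable def costFrom (G : MeanFieldGame X A) (μ : ℕ → ProbabilityMeasure X)
    (π : MarkovPolicy X A) : ℕ → ℕ → ℝ
  | 0, _ => 0
  | k + 1, t => ∫ z, G.c z.1 z.2 (μ t) ∂(G.stateActionLaw μ π t) +
      G.β * G.costFrom μ π k (t + 1)

/-- Links the recursion suited to backward induction with the sum suited to tail estimates. -/
theorem costFrom_eq_sum (G : MeanFieldGame X A) (μ : ℕ → ProbabilityMeasure X)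
    (π : MarkovPolicy X A) (k : ℕ) : ∀ t, G.costFrom μ π k t = ∑ j ∈ Finset.range k,
      G.β ^ j * ∫ z, G.c z.1 z.2 (μ (t + j)) ∂(G.stateActionLaw μ π (t + j)) := by
  induction k with
  | zero => intro t; simp [costFrom]
  | succ k ih =>
    intro t
    rw [costFrom, ih, Finset.sum_range_succ', Finset.mul_sum, add_comm]
    simp only [pow_zero, one_mul, add_zero, pow_succ']
    congr 1
    refine Finset.sum_congr rfl fun j _ => ?_
    rw [mul_assoc, show t + 1 + j = t + (j + 1) by omega]

theorem partialCost_eq_costFrom (G : MeanFieldGame X A) (μ : ℕ → ProbabilityMeasure X)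
    (π : MarkovPolicy X A) (N : ℕ) : G.partialCost μ π N = G.costFrom μ π N 0 := by
  simp [partialCost, costFrom_eq_sum]

theorem integral_fst_stateActionLaw {X A : Type*} [TopologicalSpace X] [MeasurableSpace X]
    [OpensMeasurableSpace X] [MeasurableSpace A] (G : MeanFieldGame X A) {f : X → ℝ}
    (hf : Continuous f) (μ : ℕ → ProbabilityMeasure X)
    (π : MarkovPolicy X A) (t : ℕ) :
    ∫ x, f x ∂(G.stateActionLaw μ π t).fst = ∫ z, f z.1 ∂(G.stateActionLaw μ π t) := by
  rw [Measure.fst, integral_map measurable_fst.aemeasurable hf.measurable.aestronglyMeasurable]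

theorem abs_partialCost_sub_le (G : MeanFieldGame X A) {M : ℝ}
    (hM : ∀ x a μ, |G.c x a μ| ≤ M) (μ : ℕ → ProbabilityMeasure X) (π : MarkovPolicy X A)
    {N K : ℕ} (hNK : N ≤ K) :
    |G.partialCost μ π N - G.partialCost μ π K| ≤ M * G.β ^ N / (1 - G.β) := by
  refine abs_sum_range_sub_sum_range_le_geometric G.β_lt_one G.β_nonneg (fun t => ?_) hNK
  rw [abs_mul, abs_of_nonneg (pow_nonneg G.β_nonneg t), mul_comm M]
  refine mul_le_mul_of_nonneg_left ?_ (pow_nonneg G.β_nonneg t)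
  simpa using norm_integral_le_of_norm_le_const (μ := G.stateActionLaw μ π t)
    (f := fun z => G.c z.1 z.2 (μ t)) (ae_of_all _ fun z => hM z.1 z.2 (μ t))

end Value

/-! ### Continuity and optimality of the value function -/

section Compact

variable {X A : Type*} [MetricSpace X] [CompactSpace X] [MeasurableSpace X] [BorelSpace X]
  [MetricSpace A] [MeasurableSpace A] {G : MeanFieldGame X A}

/-- Sequential continuity is enough because weak convergence on a compact metric space is
metrizable. -/
theorem ContinuousConvergence.continuous_cost (hG : G.ContinuousConvergence) :
    Continuous fun z : (X × A) × ProbabilityMeasure X => G.c z.1.1 z.1.2 z.2 :=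
  SeqContinuous.continuous fun _ z hu => (hG _ _ _ z.1.1 z.1.2 z.2
    ((continuous_fst.comp continuous_fst).tendsto z |>.comp hu)
    ((continuous_snd.comp continuous_fst).tendsto z |>.comp hu)
    (continuous_snd.tendsto z |>.comp hu)).1

theorem ContinuousConvergence.continuous_transition (hG : G.ContinuousConvergence) :
    Continuous fun z : (X × A) × ProbabilityMeasure X => G.p z.1.1 z.1.2 z.2 :=
  SeqContinuous.continuous fun _ z hu => (hG _ _ _ z.1.1 z.1.2 z.2
    ((continuous_fst.comp continuous_fst).tendsto z |>.comp hu)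
    ((continuous_snd.comp continuous_fst).tendsto z |>.comp hu)
    (continuous_snd.tendsto z |>.comp hu)).2

theorem ContinuousConvergence.continuous_cost_apply (hG : G.ContinuousConvergence)
    (μ : ProbabilityMeasure X) : Continuous fun z : X × A => G.c z.1 z.2 μ :=
  hG.continuous_cost.comp (Continuous.prodMk_left μ)

variable [CompactSpace A]

/-- The value function is jointly continuous in the flow and the state. -/
theorem ContinuousConvergence.continuous_value (hG : G.ContinuousConvergence) (k : ℕ) :
    ∀ t, Continuous fun w : (ℕ → ProbabilityMeasure X) × X => G.value w.1 k t w.2 := by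
  induction k with
  | zero => intro t; exact continuous_const
  | succ k ih =>
    intro t
    refine continuous_iInf_of_compact (q := fun (w : (ℕ → ProbabilityMeasure X) × X) (a : A) =>
      G.actionValue w.1 k t w.2 a) ?_
    have hz : Continuous fun w : ((ℕ → ProbabilityMeasure X) × X) × A =>
        ((w.1.2, w.2), w.1.1 t) := by fun_prop
    refine (hG.continuous_cost.comp hz).add (continuous_const.mul ?_)
    -- The flow moves the integrand as well as the measure, which is why the induction carries joint
    -- continuity.
    refine continuous_integral_probabilityMeasure
      (v := fun (w : ((ℕ → ProbabilityMeasure X) × X) × A) y => G.value w.1.1 k (t + 1) y)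
      ((ih (t + 1)).comp (f := fun w : (((ℕ → ProbabilityMeasure X) × X) × A) × X =>
        (w.1.1.1, w.2)) (by fun_prop)) (hG.continuous_transition.comp hz)

theorem ContinuousConvergence.continuous_value_apply (hG : G.ContinuousConvergence)
    (μ : ℕ → ProbabilityMeasure X) (k t : ℕ) : Continuous (G.value μ k t) :=
  (hG.continuous_value k t).comp (Continuous.prodMk_right μ)

theorem ContinuousConvergence.continuous_actionValue (hG : G.ContinuousConvergence)
    (μ : ℕ → ProbabilityMeasure X) (k t : ℕ) :
    Continuous (Function.uncurry (G.actionValue μ k t)) := by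
  have hz : Continuous fun z : X × A => (z, μ t) := by fun_prop
  refine (hG.continuous_cost.comp hz).add (continuous_const.mul ?_)
  exact continuous_integral_probabilityMeasure
    (v := fun (_ : X × A) y => G.value μ k (t + 1) y)
    ((hG.continuous_value_apply μ k (t + 1)).comp continuous_snd)
    (hG.continuous_transition.comp hz)

variable [BorelSpace A]

/-- The averaged Bellman step: integrating the transition kernel against the law at `t` gives the
state law at `t + 1`. -/
theorem ContinuousConvergence.integral_actionValue (hG : G.ContinuousConvergence)
    (μ : ℕ → ProbabilityMeasure X) (π : MarkovPolicy X A) (k t : ℕ) :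
    ∫ z, G.actionValue μ k t z.1 z.2 ∂(G.stateActionLaw μ π t) =
      ∫ z, G.c z.1 z.2 (μ t) ∂(G.stateActionLaw μ π t) +
        G.β * ∫ x, G.value μ k (t + 1) x ∂(G.stateActionLaw μ π (t + 1)).fst := by
  have hz : Continuous fun z : X × A => (z, μ t) := by fun_prop
  have hi : Continuous fun z : X × A => ∫ y, G.value μ k (t + 1) y ∂(G.p z.1 z.2 (μ t)) :=
    continuous_integral_probabilityMeasure (v := fun (_ : X × A) y => G.value μ k (t + 1) y)
      ((hG.continuous_value_apply μ k (t + 1)).comp continuous_snd)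
      (hG.continuous_transition.comp hz)
  simp only [actionValue]
  rw [integral_add ((hG.continuous_cost_apply (μ t)).integrable_of_compactSpace _)
    ((hi.integrable_of_compactSpace _).const_mul G.β), integral_const_mul,
    fst_stateActionLaw_succ, Measure.integral_bind_kernel]
  · rfl
  · exact (hG.continuous_value_apply μ k (t + 1)).integrable_of_compactSpace _

/-- No policy does better than the value function. -/
theorem ContinuousConvergence.integral_value_le_costFrom (hG : G.ContinuousConvergence)
    (μ : ℕ → ProbabilityMeasure X) (π : MarkovPolicy X A) (k : ℕ) :
    ∀ t, ∫ x, G.value μ k t x ∂(G.stateActionLaw μ π t).fst ≤ G.costFrom μ π k t := by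
  induction k with
  | zero => intro t; simp [value, costFrom]
  | succ k ih =>
    intro t
    calc ∫ x, G.value μ (k + 1) t x ∂(G.stateActionLaw μ π t).fst
        = ∫ z, G.value μ (k + 1) t z.1 ∂(G.stateActionLaw μ π t) :=
          integral_fst_stateActionLaw G (hG.continuous_value_apply μ (k + 1) t) μ π t
      _ ≤ ∫ z, G.actionValue μ k t z.1 z.2 ∂(G.stateActionLaw μ π t) :=
          integral_mono
            (((hG.continuous_value_apply μ (k + 1) t).comp
              continuous_fst).integrable_of_compactSpace _)
            ((hG.continuous_actionValue μ k t).integrable_of_compactSpace _)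
            fun z => ciInf_le (bddBelow_range_of_compact (hG.continuous_actionValue μ k t) z.1) z.2
      _ ≤ G.costFrom μ π (k + 1) t := by
          rw [hG.integral_actionValue, costFrom]
          gcongr
          · exact G.β_nonneg
          · exact ih (t + 1)

/-- Some policy comes within `N * ε` of the value function of the `N`-stage problem. -/
theorem ContinuousConvergence.exists_partialCost_le (hG : G.ContinuousConvergence) [Nonempty A]
    (μ : ℕ → ProbabilityMeasure X) (N : ℕ) {ε : ℝ} (hε : 0 < ε) :
    ∃ π : MarkovPolicy X A,
      G.partialCost μ π N ≤ ∫ x, G.value μ N 0 x ∂(G.μ₀ : Measure X) + N * ε := by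
  -- At time `t < N`, `N - (t + 1)` stages remain after the current one; the selectors for `t ≥ N`
  -- play no role.
  choose s hs hsε using fun t => exists_measurable_approx_minimizer
    (hG.continuous_actionValue μ (N - (t + 1)) t) hε
  let π : MarkovPolicy X A := ⟨fun t => Kernel.deterministic (s t) (hs t), fun t => inferInstance⟩
  have key : ∀ k t, t + k = N →
      G.costFrom μ π k t ≤ ∫ x, G.value μ k t x ∂(G.stateActionLaw μ π t).fst + k * ε := by
    intro k
    induction k with
    | zero => intro t _; simp [value, costFrom]
    | succ k ih =>
      intro t ht
      have hk : N - (t + 1) = k := by omega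
      have h₁ : ∫ z, G.actionValue μ k t z.1 z.2 ∂(G.stateActionLaw μ π t) ≤
          ∫ x, G.value μ (k + 1) t x ∂(G.stateActionLaw μ π t).fst + ε := by
        have hq := (hG.continuous_actionValue μ k t)
        rw [stateActionLaw_eq_fst_compProd, Measure.integral_compProd
          (f := fun z => G.actionValue μ k t z.1 z.2) (hq.integrable_of_compactSpace _),
          Measure.fst_compProd]
        have hdet : ∀ x, ∫ a, G.actionValue μ k t x a ∂(π.kernel t x) =
            G.actionValue μ k t x (s t x) := fun x => by
          rw [Kernel.deterministic_apply]
          exact integral_dirac' _ _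
            (hq.comp (Continuous.prodMk_right x)).measurable.stronglyMeasurable
        have hv := (hG.continuous_value_apply μ (k + 1) t).integrable_of_compactSpace
          (G.stateActionLaw μ π t).fst
        -- `s t` is only measurable, so integrability comes from the continuous `actionValue` under
        -- the pushforward law on the graph of `s t`.
        have hqs := (hq.integrable_of_compactSpace ((G.stateActionLaw μ π t).fst.map
          fun x => (x, s t x))).comp_measurable (measurable_id.prodMk (hs t))
        simp only [hdet]
        calc ∫ x, G.actionValue μ k t x (s t x) ∂(G.stateActionLaw μ π t).fst
            ≤ ∫ x, (G.value μ (k + 1) t x + ε) ∂(G.stateActionLaw μ π t).fst := by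
              refine integral_mono hqs (hv.add (integrable_const ε)) fun x => ?_
              have := hsε t x
              rw [hk] at this
              simpa only [value_succ] using this
          _ = _ := by rw [integral_add hv (integrable_const ε)]; simp
      rw [hG.integral_actionValue] at h₁
      have h₂ := mul_le_mul_of_nonneg_left (ih (t + 1) (by omega)) G.β_nonneg
      -- Discounting does not amplify later errors, so each stage adds at most `ε`.
      have h₃ : G.β * (k * ε) ≤ k * ε :=
        mul_le_of_le_one_left (by positivity) G.β_lt_one.le
      rw [costFrom]
      push_cast
      linarith
  refine ⟨π, ?_⟩
  have := key N 0 (zero_add N)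
  rwa [fst_stateActionLaw_zero, ← partialCost_eq_costFrom] at this

theorem ContinuousConvergence.integral_cost_eq (hG : G.ContinuousConvergence)
    (μ : ℕ → ProbabilityMeasure X) (π : MarkovPolicy X A) (t : ℕ) :
    ∫ z, G.c z.1 z.2 (μ t) ∂(G.stateActionLaw μ π t) =
      ∫ ω, G.c (ω t).1 (ω t).2 (μ t) ∂(G.pathLaw μ π) :=
  integral_map (measurable_pi_apply t).aemeasurable
    (hG.continuous_cost_apply (μ t)).aestronglyMeasurable

theorem ContinuousConvergence.integrable_pathCost (hG : G.ContinuousConvergence)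
    (μ : ℕ → ProbabilityMeasure X) (π : MarkovPolicy X A) (t : ℕ) :
    Integrable (fun ω => G.β ^ t * G.c (ω t).1 (ω t).2 (μ t)) (G.pathLaw μ π) :=
  (((hG.continuous_cost_apply (μ t)).integrable_of_compactSpace
    (G.stateActionLaw μ π t)).comp_measurable (measurable_pi_apply t)).const_mul _

theorem ContinuousConvergence.partialCost_eq_integral (hG : G.ContinuousConvergence)
    (μ : ℕ → ProbabilityMeasure X) (π : MarkovPolicy X A) (N : ℕ) : G.partialCost μ π N =
      ∫ ω, ∑ t ∈ Finset.range N, G.β ^ t * G.c (ω t).1 (ω t).2 (μ t) ∂(G.pathLaw μ π) := by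
  rw [integral_finsetSum _ fun t _ => hG.integrable_pathCost μ π t, partialCost]
  simp only [integral_const_mul, hG.integral_cost_eq]

theorem ContinuousConvergence.abs_partialCost_sub_infiniteCost_le (hG : G.ContinuousConvergence)
    {M : ℝ} (hM : ∀ x a μ, |G.c x a μ| ≤ M) (μ : ℕ → ProbabilityMeasure X)
    (π : MarkovPolicy X A) (N : ℕ) :
    |G.partialCost μ π N - G.infiniteCost μ π| ≤ M * G.β ^ N / (1 - G.β) := by
  let u : (ℕ → X × A) → ℕ → ℝ := fun ω t => G.β ^ t * G.c (ω t).1 (ω t).2 (μ t)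
  have hu : ∀ ω t, ‖u ω t‖ ≤ M * G.β ^ t := fun ω t => by
    rw [norm_mul, Real.norm_of_nonneg (pow_nonneg G.β_nonneg t), mul_comm M]
    exact mul_le_mul_of_nonneg_left (hM _ _ _) (pow_nonneg G.β_nonneg t)
  have hsum : ∀ ω, HasSum (u ω) (∑' t, u ω t) := fun ω => by
    refine (Summable.of_norm_bounded ?_ (hu ω)).hasSum
    exact (summable_geometric_of_lt_one G.β_nonneg G.β_lt_one).mul_left M
  have hb : ∀ n ω, ‖∑ t ∈ Finset.range n, u ω t - ∑' t, u ω t‖ ≤ M * G.β ^ n / (1 - G.β) :=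
    fun n ω => norm_sub_le_of_geometric_bound_of_hasSum G.β_lt_one (hu ω) (hsum ω) n
  have hint : ∀ t, Integrable (fun ω => u ω t) (G.pathLaw μ π) := hG.integrable_pathCost μ π
  have hfin : Integrable (fun ω => ∑ t ∈ Finset.range N, u ω t) (G.pathLaw μ π) :=
    integrable_finsetSum _ fun t _ => hint t
  have htsum : Integrable (fun ω => ∑' t, u ω t) (G.pathLaw μ π) := by
    -- The series is measurable as a limit of partial sums; its bound is the tail estimate for the
    -- empty sum.
    refine Integrable.of_bound (C := M * G.β ^ 0 / (1 - G.β)) ?_ (ae_of_all _ fun ω => ?_)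
    · exact aestronglyMeasurable_of_tendsto_ae atTop
        (f := fun n ω => ∑ t ∈ Finset.range n, u ω t)
        (fun n => (integrable_finsetSum _ fun t _ => hint t).aestronglyMeasurable)
        (ae_of_all _ fun ω => (hsum ω).tendsto_sum_nat)
    · simpa using hb 0 ω
  rw [hG.partialCost_eq_integral, infiniteCost, ← integral_sub hfin htsum]
  simpa using norm_integral_le_of_norm_le_const (μ := G.pathLaw μ π) (ae_of_all _ (hb N))

end Compact

end MeanFieldGame

/-! ### Disintegration and passage to the limit -/

theorem exists_stateActionFlow_eq {X A : Type*} [MeasurableSpace X] [MeasurableSpace A]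
    [StandardBorelSpace A] (ρ : ℕ → ProbabilityMeasure (X × A)) :
    ∃ (π : MarkovPolicy X A) (μ : ℕ → ProbabilityMeasure X), stateActionFlow π μ = ρ := by
  have : Nonempty A := ⟨(ρ 0).nonempty.some.2⟩
  refine ⟨⟨fun t => (ρ t : Measure (X × A)).condKernel, fun t => inferInstance⟩,
    fun t => ⟨(ρ t : Measure (X × A)).fst, inferInstance⟩, ?_⟩
  funext t
  exact Subtype.ext (Measure.disintegrate _ _)

namespace MeanFieldGame

section Limit

variable {X A : Type*} [MetricSpace X] [MeasurableSpace X] [BorelSpace X]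
  [MetricSpace A] [CompactSpace A] [MeasurableSpace A] [BorelSpace A] {G : MeanFieldGame X A}

/-- The flow of state marginals of a state-action flow. -/
noncomputable def stateMarginals {X A : Type*} [MeasurableSpace X] [MeasurableSpace A]
    (ρ : ℕ → ProbabilityMeasure (X × A)) (t : ℕ) : ProbabilityMeasure X :=
  (ρ t).map measurable_fst.aemeasurable

theorem stateMarginals_stateActionFlow {X A : Type*} [MeasurableSpace X] [MeasurableSpace A]
    (π : MarkovPolicy X A) (μ : ℕ → ProbabilityMeasure X) :
    stateMarginals (stateActionFlow π μ) = μ := by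
  funext t
  exact Subtype.ext (Measure.fst_compProd (μ t : Measure X) (π.kernel t))

theorem continuous_stateMarginals : Continuous (stateMarginals (X := X) (A := A)) :=
  continuous_pi fun t => (ProbabilityMeasure.continuous_map continuous_fst).comp (continuous_apply t)

/-- A closed set that contains all extended equilibria with large horizons contains their
accumulation points. -/
theorem IsHorizonAccumulationPoint.mem_of_isClosed {ρ : ℕ → ProbabilityMeasure (X × A)}
    (hρ : G.IsHorizonAccumulationPoint ρ) {C : Set (ℕ → ProbabilityMeasure (X × A))}
    (hC : IsClosed C) (h : ∀ᶠ T in atTop, G.extendedMFE T ⊆ C) : ρ ∈ C := by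
  by_contra hmem
  obtain ⟨T, ⟨ρ', hρ', hρT⟩, hT⟩ := ((hρ _ (hC.isOpen_compl.mem_nhds hmem)).and_eventually h).exists
  exact hρ' (hT hρT)

/-- Freezing is invisible up to time `T`, and there consistency identifies `ρ t` with a single
player's law, turning integrals against `ρ` into expected costs. -/
theorem extendedMFE_elim {X A : Type*} [MeasurableSpace X] [MeasurableSpace A]
    {G : MeanFieldGame X A} {T : ℕ} {ρ : ℕ → ProbabilityMeasure (X × A)}
    (h : ρ ∈ G.extendedMFE T) : ∃ (π : MarkovPolicy X A) (μ : ℕ → ProbabilityMeasure X),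
      G.IsFiniteMFE T π μ ∧ ∀ t ≤ T, stateMarginals ρ t = μ t ∧
        (ρ t : Measure (X × A)) = G.stateActionLaw μ π t := by
  obtain ⟨π, μ, hM, rfl⟩ := h
  refine ⟨π, μ, hM, fun t ht => ⟨?_, ?_⟩⟩
  · rw [stateMarginals_stateActionFlow]
    exact if_pos ht
  · rw [G.stateActionLaw_eq_of_consistent μ π (T := T) hM.2.1
      (fun s hs => hM.2.2 s (by exact_mod_cast hs)) t (by exact_mod_cast ht)]
    simp [stateActionFlow, MarkovPolicy.freeze, freezeMeasures, ht]

theorem IsHorizonAccumulationPoint.stateMarginals_zero {ρ : ℕ → ProbabilityMeasure (X × A)}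
    (hρ : G.IsHorizonAccumulationPoint ρ) : stateMarginals ρ 0 = G.μ₀ := by
  refine hρ.mem_of_isClosed (C := {ρ | stateMarginals ρ 0 = G.μ₀})
    (isClosed_eq ((continuous_apply 0).comp continuous_stateMarginals) continuous_const)
    (Eventually.of_forall fun T ρ' h => ?_)
  obtain ⟨π, μ, hM, h⟩ := extendedMFE_elim h
  exact (h 0 T.zero_le).1.trans hM.2.1

variable [CompactSpace X]

/-- For each test function `f` both sides are continuous in `ρ`, the inner integral jointly in `ρ`
and the state-action pair, so equality is closed; it holds at every horizon `T ≥ t + 1`. -/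
theorem IsHorizonAccumulationPoint.stateMarginals_succ (hG : G.ContinuousConvergence)
    {ρ : ℕ → ProbabilityMeasure (X × A)} (hρ : G.IsHorizonAccumulationPoint ρ) (t : ℕ) :
    (stateMarginals ρ (t + 1) : Measure X) =
      (ρ t : Measure (X × A)).bind (G.transition (stateMarginals ρ t)) := by
  refine ext_of_forall_integral_eq_of_IsFiniteMeasure fun f => ?_
  rw [Measure.integral_bind_kernel _ _ (f.integrable _)]
  have hz : Continuous fun w : (ℕ → ProbabilityMeasure (X × A)) × (X × A) =>
      (w.2, stateMarginals w.1 t) :=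
    continuous_snd.prodMk ((continuous_apply t).comp (continuous_stateMarginals.comp continuous_fst))
  have hinner : Continuous fun w : (ℕ → ProbabilityMeasure (X × A)) × (X × A) =>
      ∫ y, f y ∂(G.p w.2.1 w.2.2 (stateMarginals w.1 t) : Measure X) :=
    (ProbabilityMeasure.continuous_integral_boundedContinuousFunction f).comp
      (hG.continuous_transition.comp hz)
  refine hρ.mem_of_isClosed (C := {ρ | ∫ x, f x ∂(stateMarginals ρ (t + 1) : Measure X) =
      ∫ z, ∫ y, f y ∂(G.p z.1 z.2 (stateMarginals ρ t) : Measure X) ∂(ρ t : Measure (X × A))})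
    (isClosed_eq ?_ ?_) ?_
  · exact (ProbabilityMeasure.continuous_integral_boundedContinuousFunction f).comp
      ((continuous_apply (t + 1)).comp continuous_stateMarginals)
  · exact continuous_integral_probabilityMeasure (v := fun ρ (z : X × A) =>
      ∫ y, f y ∂(G.p z.1 z.2 (stateMarginals ρ t) : Measure X)) hinner (continuous_apply t)
  · filter_upwards [eventually_ge_atTop (t + 1)] with T hT ρ' h
    obtain ⟨π, μ, hM, h⟩ := extendedMFE_elim h
    obtain ⟨h₁, h₂⟩ := h t (by omega)
    have h₃ : (stateMarginals ρ' (t + 1) : Measure X) =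
        (G.stateActionLaw μ π t).bind (G.transition (μ t)) := by
      rw [← fst_stateActionLaw_succ, ← (h (t + 1) hT).2]; rfl
    change ∫ x, f x ∂(stateMarginals ρ' (t + 1) : Measure X) =
      ∫ z, ∫ y, f y ∂(G.p z.1 z.2 (stateMarginals ρ' t) : Measure X) ∂(ρ' t : Measure (X × A))
    rw [h₁, h₂, h₃, Measure.integral_bind_kernel _ _ (f.integrable _)]
    rfl

/-- Accumulation points are optimal for the truncated problems, up to the discounted tails. -/
theorem IsHorizonAccumulationPoint.sum_integral_cost_le (hG : G.ContinuousConvergence) {M : ℝ}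
    (hM : ∀ x a μ, |G.c x a μ| ≤ M) {ρ : ℕ → ProbabilityMeasure (X × A)}
    (hρ : G.IsHorizonAccumulationPoint ρ) (N : ℕ) :
    ∑ t ∈ Finset.range N,
        G.β ^ t * ∫ z, G.c z.1 z.2 (stateMarginals ρ t) ∂(ρ t : Measure (X × A)) ≤
      ∫ x, G.value (stateMarginals ρ) N 0 x ∂(G.μ₀ : Measure X) +
        2 * (M * G.β ^ N / (1 - G.β)) := by
  have : Nonempty A := ⟨(ρ 0).nonempty.some.2⟩
  refine hρ.mem_of_isClosed (C := {ρ | ∑ t ∈ Finset.range N,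
      G.β ^ t * ∫ z, G.c z.1 z.2 (stateMarginals ρ t) ∂(ρ t : Measure (X × A)) ≤
    ∫ x, G.value (stateMarginals ρ) N 0 x ∂(G.μ₀ : Measure X) +
      2 * (M * G.β ^ N / (1 - G.β))}) (isClosed_le ?_ ?_) ?_
  · refine continuous_finsetSum _ fun t _ => continuous_const.mul ?_
    exact continuous_integral_probabilityMeasure
      (v := fun ρ (z : X × A) => G.c z.1 z.2 (stateMarginals ρ t))
      (hG.continuous_cost.comp (continuous_snd.prodMk
        ((continuous_apply t).comp (continuous_stateMarginals.comp continuous_fst))))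
      (continuous_apply t)
  · exact (continuous_integral_probabilityMeasure
      (v := fun (ρ : ℕ → ProbabilityMeasure (X × A)) x => G.value (stateMarginals ρ) N 0 x)
      ((hG.continuous_value N 0).comp
        ((continuous_stateMarginals.comp continuous_fst).prodMk continuous_snd))
      continuous_const).add continuous_const
  · filter_upwards [eventually_ge_atTop N] with T hT ρ' h
    obtain ⟨π, μ, hE, h⟩ := extendedMFE_elim h
    have hcost : ∑ t ∈ Finset.range N,
        G.β ^ t * ∫ z, G.c z.1 z.2 (stateMarginals ρ' t) ∂(ρ' t : Measure (X × A)) =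
          G.partialCost μ π N := Finset.sum_congr rfl fun t ht => by
      obtain ⟨h₁, h₂⟩ := h t ((Finset.mem_range.1 ht).le.trans hT)
      rw [h₁, h₂]
    have hvalue : G.value (stateMarginals ρ') N 0 = G.value μ N 0 :=
      G.value_congr N 0 fun s hs => (h s (by omega)).1
    change ∑ t ∈ Finset.range N,
        G.β ^ t * ∫ z, G.c z.1 z.2 (stateMarginals ρ' t) ∂(ρ' t : Measure (X × A)) ≤
      ∫ x, G.value (stateMarginals ρ') N 0 x ∂(G.μ₀ : Measure X) +
        2 * (M * G.β ^ N / (1 - G.β))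
    rw [hcost, hvalue]
    refine le_of_forall_pos_le_add fun δ hδ => ?_
    -- Dividing by `N + 1` keeps the total error below `δ` and also covers `N = 0`.
    obtain ⟨σ, hσ⟩ := hG.exists_partialCost_le μ N (ε := δ / (N + 1)) (by positivity)
    have hN : (N : ℝ) * (δ / (N + 1)) ≤ δ := by
      rw [mul_div_assoc', div_le_iff₀ (by positivity)]
      nlinarith
    have hopt := hE.1 σ
    rw [finiteCost, finiteCost, ← hG.partialCost_eq_integral, ← hG.partialCost_eq_integral] at hopt
    -- Horizon `T` has `T + 1` stages. One tail passes from `N` stages to `T + 1` for `π`, the other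
    -- back to `N` for `σ`.
    have h₁ := abs_le.1 (G.abs_partialCost_sub_le hM μ π (hT.trans T.le_succ))
    have h₂ := abs_le.1 (G.abs_partialCost_sub_le hM μ σ (hT.trans T.le_succ))
    simp only [Nat.succ_eq_add_one] at h₁ h₂
    linarith [h₁.2, h₂.1]

theorem IsHorizonAccumulationPoint.isInfiniteMFE (hG : G.ContinuousConvergence) {M : ℝ}
    (hM : ∀ x a μ, |G.c x a μ| ≤ M) {π : MarkovPolicy X A} {μ : ℕ → ProbabilityMeasure X}
    (hρ : G.IsHorizonAccumulationPoint (stateActionFlow π μ)) : G.IsInfiniteMFE π μ := by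
  have h₀ := hρ.stateMarginals_zero
  have hsucc := hρ.stateMarginals_succ hG
  rw [stateMarginals_stateActionFlow] at h₀ hsucc
  refine ⟨fun π' => ?_, h₀, hsucc⟩
  have hlaw : ∀ t, G.stateActionLaw μ π t = (stateActionFlow π μ t : Measure (X × A)) := fun t =>
    G.stateActionLaw_eq_of_consistent μ π (T := ⊤) h₀ (fun t _ => hsucc t) t le_top
  -- Of the four tails, two come from the near-optimality bound and one each from truncating the
  -- costs of `π` and `π'`.
  have key : ∀ N : ℕ, G.infiniteCost μ π ≤
      G.infiniteCost μ π' + 4 * (M * G.β ^ N / (1 - G.β)) := fun N => by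
    have h₁ := hρ.sum_integral_cost_le hG hM N
    simp only [stateMarginals_stateActionFlow, ← hlaw] at h₁
    have h₂ := hG.integral_value_le_costFrom μ π' N 0
    rw [fst_stateActionLaw_zero, ← partialCost_eq_costFrom] at h₂
    have h₃ := abs_le.1 (hG.abs_partialCost_sub_infiniteCost_le hM μ π N)
    have h₄ := abs_le.1 (hG.abs_partialCost_sub_infiniteCost_le hM μ π' N)
    simp only [partialCost] at h₂ h₃ h₄
    linarith [h₃.1, h₄.2]
  have hlim : Tendsto (fun N : ℕ => G.infiniteCost μ π' + 4 * (M * G.β ^ N / (1 - G.β))) atTop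
      (𝓝 (G.infiniteCost μ π' + 4 * (M * 0 / (1 - G.β)))) :=
    ((((tendsto_pow_atTop_nhds_zero_of_lt_one G.β_nonneg G.β_lt_one).const_mul
      M).div_const _).const_mul 4).const_add _
  simpa using ge_of_tendsto' hlim key

end Limit

end MeanFieldGame

theorem mainTheorem1 {X : Type*} [MetricSpace X] [CompactSpace X] [MeasurableSpace X]
    [BorelSpace X] {m : ℕ} (A : Set (EuclideanSpace ℝ (Fin m))) (hA : IsCompact A)
    (hAconv : Convex ℝ A) (G : MeanFieldGame X A) (hcont : G.ContinuousConvergence)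
    (hLip : G.LipschitzBounded) (ρ : ℕ → ProbabilityMeasure (X × A))
    (hρ : G.IsHorizonAccumulationPoint ρ) :
    (∃ (π : MarkovPolicy X A) (μ : ℕ → ProbabilityMeasure X), stateActionFlow π μ = ρ) ∧
      ∀ (π : MarkovPolicy X A) (μ : ℕ → ProbabilityMeasure X),
        stateActionFlow π μ = ρ → G.IsInfiniteMFE π μ := by
  have : CompactSpace A := isCompact_iff_compactSpace.1 hA
  obtain ⟨M, hM⟩ := hLip.2.2
  refine ⟨exists_stateActionFlow_eq ρ, ?_⟩
  rintro π μ rfl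
  exact hρ.isInfiniteMFE hcont hM
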